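/- Let $\mathcal{X}$ be a Polish space, let $\rho$ be a metric inducing its topology (for instance, $(\mathcal{X},\rho)$ is a complete separable metric space), let $\mu$ be a Borel probability measure on $\mathcal{X}$, and let $C>0$. For $f:\mathcal{X}\to\mathbb{R}$ put \[ |\nabla^- f|(x)=\limsup_{y\to x,\ y\neq x}\frac{[f(y)-f(x)]_+}{\rho(x,y)},\qquad [a]_+=\max(a,0), \] with $|\nabla^- f|(x)=0$ if $x$ is an isolated point, and for $\mu$-integrable $g\ge 0$ put \[ \operatorname{Ent}_\mu(g)=\int g\log g\,d\mu-\int g\,d\mu\,\log\Bigl(\int g\,d\mu\Bigr)\in[0,+\infty], \] with $0\log 0=0$. Suppose that $\mu$ satisfies the modified logarithmic Sobolev inequality $\mathbf{LSI}^+(C)$: for every locally Lipschitz function $f:\mathcal{X}\to\mathbb{R}$ with $\int f^2\,d\mu<+\infty$, \[ \operatorname{Ent}_\mu(f^2)\le C\int |\nabla^- f|^2\,d\mu . \] Then $\mu$ satisfies Talagrand's transportation-cost inequality $\mathbf{T}_2(C)$ with the same constant: for every Borel probability measure $\nu$ on $\mathcal{X}$, \[ \inf_{\pi}\int \rho(x,y)^2\,d\pi(x,y)\le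 C\,\operatorname{H}(\nu\,|\,\mu), \] where $\pi$ runs over the probability measures on $\mathcal{X}\times\mathcal{X}$ with marginals $\nu$ and $\mu$, and $\operatorname{H}(\nu\,|\,\mu)=\int\log\frac{d\nu}{d\mu}\,d\nu$ if $\nu$ is absolutely continuous with respect to $\mu$, and $+\infty$ otherwise. (Both sides of either inequality may be $+\infty$.) -/

import Mathlib

open MeasureTheory Filter Topology
open scoped ENNReal

noncomputable section

namespace TransportLSI

/-- The subgradient norm `|∇⁻ f|(x) = limsup_{y → x, y ≠ x} [f y - f x]₊ / ρ(x, y)`, with values in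
`[0, ∞]`. The positive part is built into `ENNReal.ofReal`. At an isolated point the punctured
neighbourhood filter is `⊥`, and the value is `0`. -/
def subgradNorm {X : Type*} [MetricSpace X] (f : X → ℝ) (x : X) : ℝ≥0∞ :=
  limsup (fun y => ENNReal.ofReal (f y - f x) / edist x y) (𝓝[≠] x)

open Classical in
/-- The entropy `Ent_μ(g) = ∫ g log g dμ - (∫ g dμ) log (∫ g dμ)` of a nonnegative `μ`-integrable
function `g`, for a probability measure `μ`, with values in `(-∞, ∞]`. Since `t log t ≥ -1/e`, the
integral of `g log g` is `+∞` as soon as `g log g` is not integrable. -/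
def entropy {X : Type*} [MeasurableSpace X] (μ : Measure X) (g : X → ℝ) : EReal :=
  if Integrable (fun x => g x * Real.log (g x)) μ then
    ((∫ x, g x * Real.log (g x) ∂μ - (∫ x, g x ∂μ) * Real.log (∫ x, g x ∂μ) : ℝ) : EReal)
  else ⊤

/-- The inequality `LSI⁺(C)`: `Ent_μ(f²) ≤ C ∫ |∇⁻ f|² dμ` for all locally Lipschitz `f` for which
`Ent_μ(f²)` makes sense, that is, with `f² ∈ L¹(μ)`. Both sides may be infinite. -/
def LSIPlus {X : Type*} [MetricSpace X] [MeasurableSpace X] (C : ℝ) (μ : Measure X) : Prop :=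
  ∀ f : X → ℝ, LocallyLipschitz f → Integrable (fun x => f x ^ 2) μ →
    entropy μ (fun x => f x ^ 2) ≤
      ((ENNReal.ofReal C * ∫⁻ x, subgradNorm f x ^ 2 ∂μ : ℝ≥0∞) : EReal)

/-- `π` is a coupling of `ν` and `μ`: its marginals are `ν` and `μ`. -/
def IsCoupling {X : Type*} [MeasurableSpace X] (π : Measure (X × X)) (ν μ : Measure X) : Prop :=
  π.map Prod.fst = ν ∧ π.map Prod.snd = μ

/-- The optimal quadratic transportation cost `𝒯₂(ν, μ) = inf_π ∫ ρ(x, y)² dπ(x, y)`, where `π` runs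
over the couplings of `ν` and `μ`. -/
def transportCost {X : Type*} [MetricSpace X] [MeasurableSpace X] (ν μ : Measure X) : ℝ≥0∞ :=
  ⨅ (π : Measure (X × X)) (_ : IsCoupling π ν μ), ∫⁻ p, edist p.1 p.2 ^ 2 ∂π

/-- Talagrand's inequality `T₂(C)`: `𝒯₂(ν, μ) ≤ C H(ν | μ)` for all probability measures `ν`, where
`H` is the relative entropy (for probability measures, `InformationTheory.klDiv ν μ` is
`∫ log (dν/dμ) dν` if `ν ≪ μ`, and `∞` otherwise). -/
def TalagrandT2 {X : Type*} [MetricSpace X] [MeasurableSpace X] (C : ℝ) (μ : Measure X) : Prop :=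
  ∀ ν : Measure X, IsProbabilityMeasure ν →
    transportCost ν μ ≤ ENNReal.ofReal C * InformationTheory.klDiv ν μ

end TransportLSI

end

/-! ### The inf-convolution and its subgradient -/

noncomputable section

namespace TransportLSI

/-! Write `u t` for `infConv f t`, with `f` bounded. If `y` minimizes in `u t x`, then formally `∂ₜu
= f y`, so `u - t ∂ₜu = ρ(x, y)²`, while the subgradient norm of `u t` at `x` is at most `2 ρ(x,
y)`. Feeding `exp (u / (2C))` to the log-Sobolev inequality, the terms `∫ exp (u / C) u / C` cancel
and `G t = ∫ exp (u t / C) dμ` satisfies `t G' ≤ G log G`: the function `log (G t) / t` is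
nonincreasing. Its limit at `0` is at most `∫ f dμ / C`, hence `log (G 1) ≤ ∫ f dμ / C`
(`LSIPlus.log_integral_exp_infConv_le`).

Minimizers may not exist and `u` need not be differentiable in `t`, so near minimizers and forward
differences of step `h` are used, with errors `O(h²)` that vanish on refining the steps.

By the entropy variational inequality, `∫ u 1 dν - ∫ f dμ ≤ C H(ν | μ)`, and Kantorovich duality
(`transportCost_le_of_forall_infConv`) turns this into the transport bound. Duality is obtained by
Hahn-Banach on `ℕ × ℕ`, then transferred through a partition into small cells. -/

/-- A growth bound `g y - g x ≤ ρ(x, y) Φ(y)` near `x` bounds the subgradient norm by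
`lim_{y → x} Φ(y)`. -/
theorem subgradNorm_le_of_tendsto {X : Type*} [MetricSpace X] {g Φ : X → ℝ} {x : X} {B : ℝ}
    (hg : ∀ y, g y - g x ≤ dist x y * Φ y) (hΦ : Tendsto Φ (𝓝 x) (𝓝 B)) :
    subgradNorm g x ≤ ENNReal.ofReal B := by
  unfold subgradNorm
  rcases eq_or_neBot (𝓝[≠] x) with h | h
  · simp [h]
  have h1 : Tendsto (fun y => ENNReal.ofReal (Φ y)) (𝓝[≠] x) (𝓝 (ENNReal.ofReal B)) :=
    (ENNReal.continuous_ofReal.tendsto B).comp (hΦ.mono_left nhdsWithin_le_nhds)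
  rw [← h1.limsup_eq]
  refine limsup_le_limsup (Eventually.of_forall fun y => ?_)
  refine ENNReal.div_le_of_le_mul ?_
  rw [edist_dist, mul_comm, ← ENNReal.ofReal_mul dist_nonneg]
  exact ENNReal.ofReal_le_ofReal (hg y)

/-- The function `x ↦ inf_y (t f(y) + ρ(x, y)²)`, which is `t` times the Hopf-Lax semigroup at
time `t`. -/
def infConv {X : Type*} [MetricSpace X] (f : X → ℝ) (t : ℝ) (x : X) : ℝ :=
  ⨅ y, (t * f y + dist x y ^ 2)

section InfConv

variable {X : Type*} [MetricSpace X] {f : X → ℝ} {M t : ℝ}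

theorem neg_le_infConv_term (hf : ∀ y, |f y| ≤ M) (ht : 0 ≤ t) (x y : X) :
    -(t * M) ≤ t * f y + dist x y ^ 2 := by
  have h1 := mul_le_mul_of_nonneg_left (abs_le.1 (hf y)).1 ht
  nlinarith [sq_nonneg (dist x y)]

theorem infConv_le (hf : ∀ y, |f y| ≤ M) (ht : 0 ≤ t) (x y : X) :
    infConv f t x ≤ t * f y + dist x y ^ 2 :=
  ciInf_le ⟨-(t * M), by rintro _ ⟨z, rfl⟩; exact neg_le_infConv_term hf ht x z⟩ y

theorem infConv_le_mul (hf : ∀ y, |f y| ≤ M) (ht : 0 ≤ t) (x : X) :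
    infConv f t x ≤ t * f x := by
  simpa using infConv_le hf ht x x

theorem abs_infConv_le (hf : ∀ y, |f y| ≤ M) (ht : 0 ≤ t) (x : X) :
    |infConv f t x| ≤ t * M := by
  have : Nonempty X := ⟨x⟩
  refine abs_le.2 ⟨le_ciInf fun y => neg_le_infConv_term hf ht x y, ?_⟩
  exact (infConv_le_mul hf ht x).trans (mul_le_mul_of_nonneg_left (abs_le.1 (hf x)).2 ht)

theorem exists_infConv_near (f : X → ℝ) (t : ℝ) (x : X) {ε : ℝ} (hε : 0 < ε) :
    ∃ y, t * f y + dist x y ^ 2 < infConv f t x + ε := by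
  have : Nonempty X := ⟨x⟩
  exact exists_lt_of_ciInf_lt (lt_add_of_pos_right _ hε)

/-- For fixed `x`, an infimum of affine functions of `t` with slopes in `[-M, M]`. -/
theorem abs_infConv_add_sub_le (hf : ∀ y, |f y| ≤ M) (ht : 0 ≤ t) {h : ℝ} (hh : 0 ≤ h) (x : X) :
    |infConv f (t + h) x - infConv f t x| ≤ h * M := by
  have : Nonempty X := ⟨x⟩
  have key : ∀ y, |h * f y| ≤ h * M := fun y => by
    rw [abs_mul, abs_of_nonneg hh]; exact mul_le_mul_of_nonneg_left (hf y) hh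
  rw [abs_le]
  constructor
  · have : infConv f t x - h * M ≤ infConv f (t + h) x := le_ciInf fun y => by
      have h1 := infConv_le hf ht x y
      have h2 := (abs_le.1 (key y)).1
      linarith
    linarith
  · have : infConv f (t + h) x - h * M ≤ infConv f t x := le_ciInf fun y => by
      have h1 := infConv_le hf (add_nonneg ht hh) x y
      have h2 := (abs_le.1 (key y)).2
      linarith
    linarith

/-- Moving the base point, in terms of a near minimizer `y`. -/
theorem infConv_sub_le (hf : ∀ y, |f y| ≤ M) (ht : 0 ≤ t) {ε : ℝ} {x y : X}
    (hy : t * f y + dist x y ^ 2 < infConv f t x + ε) (z : X) :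
    infConv f t z - infConv f t x ≤ ε + dist x z * (2 * dist x y + dist x z) := by
  have h1 := infConv_le hf ht z y
  have h2 : dist z y ≤ dist x z + dist x y := by
    rw [dist_comm x z]; exact dist_triangle z x y
  have h3 : dist z y ^ 2 ≤ (dist x z + dist x y) ^ 2 := by gcongr
  nlinarith

/-- Near minimizers stay within bounded distance of `x` because `f` is bounded. -/
theorem infConv_dist_le (hf : ∀ y, |f y| ≤ M) (ht : 0 ≤ t) (x z : X) (hxz : dist x z ≤ 1) :
    infConv f t z - infConv f t x ≤ (2 * √(2 * t * M + 1) + 1) * dist x z := by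
  have key : ∀ ε, 0 < ε → ε ≤ 1 →
      infConv f t z - infConv f t x ≤ (2 * √(2 * t * M + 1) + 1) * dist x z + ε := by
    intro ε hε hε1
    obtain ⟨y, hy⟩ := exists_infConv_near f t x hε
    have h1 := infConv_sub_le hf ht hy z
    have h2 : dist x y ≤ √(2 * t * M + 1) := by
      apply Real.le_sqrt_of_sq_le
      have h3 := (abs_le.1 (abs_infConv_le hf ht x)).2
      have h4 := mul_le_mul_of_nonneg_left (abs_le.1 (hf y)).1 ht
      linarith
    have h5 : dist x z * (2 * dist x y + dist x z) ≤
        dist x z * (2 * √(2 * t * M + 1) + 1) := by gcongr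
    linarith
  by_contra hlt
  push Not at hlt
  set a := infConv f t z - infConv f t x
  set b := (2 * √(2 * t * M + 1) + 1) * dist x z
  have h1 := key (min ((a - b) / 2) 1) (lt_min (by linarith) one_pos) (min_le_right _ _)
  have h2 := min_le_left ((a - b) / 2) 1
  linarith

theorem locallyLipschitz_infConv (hf : ∀ y, |f y| ≤ M) (ht : 0 ≤ t) :
    LocallyLipschitz (infConv f t) := by
  intro x
  refine ⟨Real.toNNReal (2 * √(2 * t * M + 1) + 1), Metric.ball x (1 / 2),
    Metric.ball_mem_nhds x (by norm_num), ?_⟩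
  refine LipschitzOnWith.of_le_add_mul _ fun y hy z hz => ?_
  have h1 : dist z y ≤ 1 := by
    have := dist_triangle_right z y x
    rw [Metric.mem_ball] at hy hz
    linarith
  rw [Real.coe_toNNReal _ (by positivity), dist_comm y z]
  linarith [infConv_dist_le hf ht z y h1]

/-- The square of the distance to a near minimizer is controlled by the forward difference
quotient in `t`. -/
theorem dist_sq_le_of_near (hf : ∀ y, |f y| ≤ M) (ht : 0 ≤ t) {h ε : ℝ} (hh : 0 < h) {x y : X}
    (hy : t * f y + dist x y ^ 2 < infConv f t x + ε) :
    dist x y ^ 2 ≤ infConv f t x - t / h * (infConv f (t + h) x - infConv f t x)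
      + ε * (1 + t / h) := by
  -- Testing time `t + h` with the near minimizer of time `t` bounds `h * f y` from below, which
  -- eliminates `t * f y` from `hy`.
  have h1 := infConv_le hf (add_nonneg ht hh.le) x y
  have h2 : t / h * (infConv f (t + h) x - infConv f t x - ε) ≤ t / h * (h * f y) :=
    mul_le_mul_of_nonneg_left (by linarith) (by positivity)
  have h3 : t / h * (h * f y) = t * f y := by field_simp
  linarith

theorem infConv_quotient_nonneg (hf : ∀ y, |f y| ≤ M) (ht : 0 ≤ t) {h : ℝ} (hh : 0 < h) (x : X) :
    0 ≤ infConv f t x - t / h * (infConv f (t + h) x - infConv f t x) := by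
  refine le_of_forall_pos_le_add fun δ hδ => ?_
  have hc : 0 < 1 + t / h := by positivity
  obtain ⟨y, hy⟩ := exists_infConv_near f t x (div_pos hδ hc)
  have := dist_sq_le_of_near hf ht hh hy
  rw [div_mul_cancel₀ _ hc.ne'] at this
  exact (sq_nonneg _).trans this

/-- The Hamilton-Jacobi inequality in integrated form: the subgradient norm of
`exp (infConv f t / (2 C))` is controlled by a forward difference quotient in `t`. -/
theorem subgradNorm_exp_infConv_le (hf : ∀ y, |f y| ≤ M) (ht : 0 ≤ t) {h C : ℝ} (hh : 0 < h)
    (hC : 0 < C) (x : X) :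
    subgradNorm (fun x => Real.exp (infConv f t x / (2 * C))) x ≤
      ENNReal.ofReal (Real.exp (infConv f t x / (2 * C)) *
        √(infConv f t x - t / h * (infConv f (t + h) x - infConv f t x)) / C) := by
  set A := infConv f t x - t / h * (infConv f (t + h) x - infConv f t x) with hA
  set κ := 1 + t / h with hκ
  refine subgradNorm_le_of_tendsto (Φ := fun z => Real.exp (infConv f t z / (2 * C)) *
    (2 * dist x z + 2 * √(A + dist x z ^ 2 * κ)) / (2 * C)) (fun z => ?_) ?_
  · rcases eq_or_ne x z with rfl | hxz
    · simp
    have hd : 0 < dist x z := dist_pos.2 hxz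
    -- The error `dist x z ^ 2` is of smaller order than `dist x z`, so it disappears as `z → x`.
    obtain ⟨y, hy⟩ := exists_infConv_near f t x (pow_pos hd 2)
    have h1 := infConv_sub_le hf ht hy z
    have h2 : dist x y ≤ √(A + dist x z ^ 2 * κ) :=
      Real.le_sqrt_of_sq_le (dist_sq_le_of_near hf ht hh hy)
    set S := √(A + dist x z ^ 2 * κ)
    have h3 : infConv f t z - infConv f t x ≤ dist x z * (2 * dist x z + 2 * S) := by
      nlinarith
    set a := infConv f t x / (2 * C)
    set b := infConv f t z / (2 * C)
    -- Convexity of `exp`; the factor sits at `z`, and continuity brings it back to `x` in the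
    -- limit.
    have h4 : Real.exp b - Real.exp a ≤ Real.exp b * (b - a) := by
      have h5 := Real.add_one_le_exp (a - b)
      have h6 : Real.exp a = Real.exp b * Real.exp (a - b) := by rw [← Real.exp_add]; ring_nf
      have h7 := mul_le_mul_of_nonneg_left h5 (Real.exp_pos b).le
      rw [h6]; linarith
    have h8 : b - a ≤ dist x z * (2 * dist x z + 2 * S) / (2 * C) := by
      rw [← sub_div]; gcongr
    calc _ ≤ Real.exp b * (b - a) := h4
      _ ≤ Real.exp b * (dist x z * (2 * dist x z + 2 * S) / (2 * C)) := by gcongr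
      _ = _ := by ring
  · have hc : ContinuousAt (fun z => Real.exp (infConv f t z / (2 * C)) *
        (2 * dist x z + 2 * √(A + dist x z ^ 2 * κ)) / (2 * C)) x := by
      have := (locallyLipschitz_infConv hf ht).continuous
      fun_prop
    convert hc.tendsto using 2
    simp
    field_simp

end InfConv

/-! ### From the log-Sobolev inequality to the dual transport inequality -/

section HamiltonJacobi

variable {X : Type*} [MetricSpace X] [MeasurableSpace X] [BorelSpace X]
  {μ : Measure X} [IsProbabilityMeasure μ] {f : X → ℝ} {M C : ℝ}

/-- The integrand is continuous and the pair takes values in a compact rectangle. -/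
theorem integrable_comp_infConv (hf : ∀ y, |f y| ≤ M) {s t : ℝ} (hs : 0 ≤ s) (ht : 0 ≤ t)
    {φ : ℝ × ℝ → ℝ} (hφ : Continuous φ) :
    Integrable (fun x => φ (infConv f s x, infConv f t x)) μ := by
  obtain ⟨K, hK⟩ := ((isCompact_Icc (a := -(s * M)) (b := s * M)).prod
    (isCompact_Icc (a := -(t * M)) (b := t * M))).exists_bound_of_continuousOn hφ.continuousOn
  have h1 := (locallyLipschitz_infConv hf hs).continuous
  have h2 := (locallyLipschitz_infConv hf ht).continuous
  refine Integrable.of_bound (Continuous.measurable (by fun_prop)).aestronglyMeasurable K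
    (Eventually.of_forall fun x => hK _ ⟨?_, ?_⟩)
  · exact abs_le.1 (abs_infConv_le hf hs x)
  · exact abs_le.1 (abs_infConv_le hf ht x)

/-- `LSI⁺(C)` applied to `exp (infConv f t / (2 C))`. -/
theorem LSIPlus.entropy_exp_infConv_le (hLSI : LSIPlus C μ) (hC : 0 < C) (hf : ∀ y, |f y| ≤ M)
    {t h : ℝ} (ht : 0 ≤ t) (hh : 0 < h) :
    ∫ x, Real.exp (infConv f t x / C) * (infConv f t x / C) ∂μ -
        (∫ x, Real.exp (infConv f t x / C) ∂μ) * Real.log (∫ x, Real.exp (infConv f t x / C) ∂μ) ≤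
      ∫ x, Real.exp (infConv f t x / C) *
        (infConv f t x - t / h * (infConv f (t + h) x - infConv f t x)) / C ∂μ := by
  have hsq : ∀ x, Real.exp (infConv f t x / (2 * C)) ^ 2 = Real.exp (infConv f t x / C) := by
    intro x
    rw [← Real.exp_nat_mul]
    congr 1
    push_cast
    field_simp
  have hth : 0 ≤ t + h := by positivity
  have hlip : LocallyLipschitz (fun x => Real.exp (infConv f t x / (2 * C))) :=
    (ContDiff.locallyLipschitz (𝕂 := ℝ) (f := fun r : ℝ => Real.exp (r / (2 * C)))
      (by fun_prop)).comp (locallyLipschitz_infConv hf ht)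
  have hint : Integrable (fun x => Real.exp (infConv f t x / C)) μ :=
    integrable_comp_infConv hf ht ht (φ := fun p => Real.exp (p.1 / C)) (by fun_prop)
  have hint2 : Integrable (fun x => Real.exp (infConv f t x / C) * (infConv f t x / C)) μ :=
    integrable_comp_infConv hf ht ht (φ := fun p => Real.exp (p.1 / C) * (p.1 / C)) (by fun_prop)
  have hint3 : Integrable (fun x => C * (Real.exp (infConv f t x / C) *
      (infConv f t x - t / h * (infConv f (t + h) x - infConv f t x)) / C ^ 2)) μ :=
    integrable_comp_infConv hf ht hth
      (φ := fun p => C * (Real.exp (p.1 / C) * (p.1 - t / h * (p.2 - p.1)) / C ^ 2)) (by fun_prop)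
  have key := hLSI _ hlip (by simpa only [hsq] using hint)
  simp only [hsq] at key
  unfold entropy at key
  rw [if_pos (by simpa only [Real.log_exp] using hint2)] at key
  simp only [Real.log_exp] at key
  have hA := infConv_quotient_nonneg hf ht hh
  have hbound : ENNReal.ofReal C *
      ∫⁻ x, subgradNorm (fun x => Real.exp (infConv f t x / (2 * C))) x ^ 2 ∂μ ≤
      ENNReal.ofReal (∫ x, C * (Real.exp (infConv f t x / C) *
        (infConv f t x - t / h * (infConv f (t + h) x - infConv f t x)) / C ^ 2) ∂μ) := by
    rw [ofReal_integral_eq_lintegral_ofReal hint3 (Eventually.of_forall fun x => by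
      have := hA x
      simp only [Pi.zero_apply]
      positivity), ← lintegral_const_mul' _ _ ENNReal.ofReal_ne_top]
    refine lintegral_mono fun x => ?_
    rw [ENNReal.ofReal_mul hC.le]
    gcongr
    refine (pow_le_pow_left' (subgradNorm_exp_infConv_le hf ht hh hC x) 2).trans ?_
    rw [← ENNReal.ofReal_pow (by positivity), div_pow, mul_pow, hsq, Real.sq_sqrt (hA x)]
  have key2 := key.trans (EReal.coe_ennreal_le_coe_ennreal_iff.2 hbound)
  have hnn : 0 ≤ ∫ x, C * (Real.exp (infConv f t x / C) *
      (infConv f t x - t / h * (infConv f (t + h) x - infConv f t x)) / C ^ 2) ∂μ :=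
    integral_nonneg fun x => by
      have := hA x
      simp only [Pi.zero_apply]
      positivity
  rw [EReal.coe_ennreal_ofReal, max_eq_left hnn, EReal.coe_le_coe_iff] at key2
  refine key2.trans_eq (integral_congr_ae (Eventually.of_forall fun x => ?_))
  simp only
  field_simp

/-- The differential inequality, in discrete form, satisfied by the logarithm of the Laplace
transform of `infConv f t`. -/
theorem LSIPlus.log_integral_exp_step (hLSI : LSIPlus C μ) (hC : 0 < C) (hf : ∀ y, |f y| ≤ M)
    {t h : ℝ} (ht : 0 < t) (hh : 0 < h) (hhM : h * M ≤ C) :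
    Real.log (∫ x, Real.exp (infConv f (t + h) x / C) ∂μ) / (t + h) ≤
      Real.log (∫ x, Real.exp (infConv f t x / C) ∂μ) / t + (M / C) ^ 2 / t * h ^ 2 := by
  have hth : 0 ≤ t + h := by positivity
  have hent := hLSI.entropy_exp_infConv_le hC hf ht.le hh
  set G := ∫ x, Real.exp (infConv f t x / C) ∂μ with hG
  set G' := ∫ x, Real.exp (infConv f (t + h) x / C) ∂μ with hG'
  have hint : Integrable (fun x => Real.exp (infConv f t x / C)) μ :=
    integrable_comp_infConv hf ht.le ht.le (φ := fun p => Real.exp (p.1 / C)) (by fun_prop)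
  have hint' : Integrable (fun x => Real.exp (infConv f (t + h) x / C)) μ :=
    integrable_comp_infConv hf hth hth (φ := fun p => Real.exp (p.1 / C)) (by fun_prop)
  have hint2 : Integrable (fun x => Real.exp (infConv f t x / C) * (infConv f t x / C)) μ :=
    integrable_comp_infConv hf ht.le ht.le (φ := fun p => Real.exp (p.1 / C) * (p.1 / C))
      (by fun_prop)
  have hint3 : Integrable (fun x => Real.exp (infConv f t x / C) *
      ((infConv f (t + h) x - infConv f t x) / C)) μ :=
    integrable_comp_infConv hf ht.le hth
      (φ := fun p => Real.exp (p.1 / C) * ((p.2 - p.1) / C)) (by fun_prop)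
  have hGpos : 0 < G := integral_exp_pos hint
  have hGpos' : 0 < G' := integral_exp_pos hint'
  set D := ∫ x, Real.exp (infConv f t x / C) *
      ((infConv f (t + h) x - infConv f t x) / C) ∂μ with hD
  -- Discrete form of `t G' ≤ G log G`, after the common entropy term cancels.
  have h1 : t / h * D ≤ G * Real.log G := by
    have h2 : ∫ x, Real.exp (infConv f t x / C) *
        (infConv f t x - t / h * (infConv f (t + h) x - infConv f t x)) / C ∂μ =
        ∫ x, Real.exp (infConv f t x / C) * (infConv f t x / C) ∂μ - t / h * D := by
      rw [hD, ← integral_const_mul, ← integral_sub hint2 (hint3.const_mul _)]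
      exact integral_congr_ae (Eventually.of_forall fun x => by simp only; ring)
    linarith
  -- Second-order expansion of `exp`, valid since the increment of the exponent is at most `h * M /
  -- C ≤ 1`.
  have h2 : G' ≤ G + D + (h * M / C) ^ 2 * G := by
    have hadd : Integrable (fun x => Real.exp (infConv f t x / C) + Real.exp (infConv f t x / C) *
      ((infConv f (t + h) x - infConv f t x) / C)) μ := hint.add hint3
    rw [hG, hG', hD, ← integral_const_mul, ← integral_add hint hint3,
      ← integral_add hadd (hint.const_mul _)]
    refine integral_mono hint' (hadd.add (hint.const_mul _)) fun x => ?_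
    simp only
    have h3 : |(infConv f (t + h) x - infConv f t x) / C| ≤ h * M / C := by
      rw [abs_div, abs_of_pos hC]
      exact div_le_div_of_nonneg_right (abs_infConv_add_sub_le hf ht.le hh.le x) hC.le
    set u := (infConv f (t + h) x - infConv f t x) / C with hu
    have h4 : |u| ≤ 1 := h3.trans ((div_le_one hC).2 hhM)
    have h5 := (abs_le.1 (Real.abs_exp_sub_one_sub_id_le h4)).2
    have h6 : u ^ 2 ≤ (h * M / C) ^ 2 := sq_le_sq' (by linarith [(abs_le.1 h3).1]) (abs_le.1 h3).2
    have h7 : infConv f (t + h) x / C = infConv f t x / C + u := by rw [hu]; ring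
    rw [h7, Real.exp_add]
    have h8 : Real.exp u ≤ 1 + u + (h * M / C) ^ 2 := by linarith
    have := mul_le_mul_of_nonneg_left h8 (Real.exp_pos (infConv f t x / C)).le
    linarith
  have h3 : D ≤ h / t * (G * Real.log G) := by
    have := mul_le_mul_of_nonneg_left h1 (show 0 ≤ h / t by positivity)
    have h4 : h / t * (t / h * D) = D := by field_simp
    linarith
  have h4 : Real.log G' - Real.log G ≤ h / t * Real.log G + (h * M / C) ^ 2 := by
    rw [← Real.log_div hGpos'.ne' hGpos.ne']
    refine (Real.log_le_sub_one_of_pos (div_pos hGpos' hGpos)).trans ?_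
    rw [sub_le_iff_le_add, div_le_iff₀ hGpos]
    linarith
  rw [div_le_iff₀ (by positivity)]
  -- The error coefficient is such that its product with `t` is exactly `(h * M / C) ^ 2`; the
  -- product with `h` is nonnegative surplus.
  have h5 : (Real.log G / t + (M / C) ^ 2 / t * h ^ 2) * (t + h) =
      Real.log G + h / t * Real.log G + (h * M / C) ^ 2 + (M / C) ^ 2 / t * h ^ 3 := by
    field_simp
    ring
  have h6 : 0 ≤ (M / C) ^ 2 / t * h ^ 3 := by positivity
  linarith

/-- A function with increments at most quadratic in the step is nonincreasing. -/
theorem le_of_forall_add_le_add_sq {φ : ℝ → ℝ} {a b K h₀ : ℝ} (hab : a ≤ b) (hh₀ : 0 < h₀)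
    (hφ : ∀ t, a ≤ t → ∀ h, 0 < h → h ≤ h₀ → φ (t + h) ≤ φ t + K * h ^ 2) : φ b ≤ φ a := by
  rcases hab.eq_or_lt with rfl | hab
  · exact le_rfl
  have hstep : ∀ h, 0 < h → h ≤ h₀ → ∀ k : ℕ, φ (a + k * h) ≤ φ a + k * (K * h ^ 2) := by
    intro h h0 h1 k
    induction k with
    | zero => simp
    | succ k ih =>
      have := hφ (a + k * h) (le_add_of_nonneg_right (by positivity)) h h0 h1
      push_cast
      rw [show a + (k + 1) * h = a + k * h + h by ring]
      linarith
  have hlim : Tendsto (fun n : ℕ => φ a + K * (b - a) ^ 2 / (n : ℝ)) atTop (𝓝 (φ a + 0)) :=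
    tendsto_const_nhds.add (tendsto_const_div_atTop_nhds_zero_nat _)
  rw [add_zero] at hlim
  refine ge_of_tendsto hlim ?_
  -- With `n` equal steps the quadratic errors add up to `K (b - a)² / n`.
  obtain ⟨n₀, hn₀⟩ := exists_nat_gt ((b - a) / h₀)
  filter_upwards [eventually_ge_atTop n₀, eventually_gt_atTop 0] with n hn hn0
  have hn0' : (0 : ℝ) < n := by exact_mod_cast hn0
  have h1 : (b - a) / n ≤ h₀ := by
    rw [div_le_iff₀ hn0']
    rw [div_lt_iff₀ hh₀] at hn₀
    have : (n₀ : ℝ) ≤ n := by exact_mod_cast hn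
    nlinarith
  have := hstep ((b - a) / n) (div_pos (by linarith) hn0') h1 n
  rw [mul_div_cancel₀ _ hn0'.ne'] at this
  have h2 : (n : ℝ) * (K * ((b - a) / n) ^ 2) = K * (b - a) ^ 2 / n := by field_simp
  rw [h2] at this
  simpa using this

/-- The dual form of `T₂(C)`. -/
theorem LSIPlus.log_integral_exp_infConv_le (hLSI : LSIPlus C μ) (hC : 0 < C)
    (hf : ∀ y, |f y| ≤ M) (hfm : Measurable f) :
    Real.log (∫ x, Real.exp (infConv f 1 x / C) ∂μ) ≤ (∫ x, f x ∂μ) / C := by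
  have hM : 0 ≤ M := by
    obtain ⟨x⟩ : Nonempty X := μ.nonempty_of_neZero
    exact (abs_nonneg _).trans (hf x)
  have hfi : Integrable f μ := Integrable.of_bound hfm.aestronglyMeasurable M
    (Eventually.of_forall hf)
  -- Monotonicity starts from `ε`, since the quotient by `t` and the error constant degenerate at
  -- `0`. The denominator `M + 1` covers `M = 0`.
  have hsmall : ∀ ε, 0 < ε → ε ≤ 1 → ε ≤ C / (M + 1) →
      Real.log (∫ x, Real.exp (infConv f 1 x / C) ∂μ) ≤ (∫ x, f x ∂μ) / C + (M / C) ^ 2 * ε := by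
    intro ε hε hε1 hεC
    have hεM : ε * M ≤ C := by
      rw [le_div_iff₀ (by positivity)] at hεC
      linarith
    have hmono : Real.log (∫ x, Real.exp (infConv f 1 x / C) ∂μ) / 1 ≤
        Real.log (∫ x, Real.exp (infConv f ε x / C) ∂μ) / ε := by
      refine le_of_forall_add_le_add_sq
        (φ := fun t => Real.log (∫ x, Real.exp (infConv f t x / C) ∂μ) / t)
        (K := (M / C) ^ 2 / ε) hε1 hε fun t ht h hh hhε => ?_
      refine (hLSI.log_integral_exp_step hC hf (hε.trans_le ht) hh
        ((mul_le_mul_of_nonneg_right hhε hM).trans hεM)).trans ?_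
      gcongr
    rw [div_one] at hmono
    refine hmono.trans ?_
    have hint : Integrable (fun x => Real.exp (infConv f ε x / C)) μ :=
      integrable_comp_infConv hf hε.le hε.le (φ := fun p => Real.exp (p.1 / C)) (by fun_prop)
    rw [div_le_iff₀ hε]
    refine (Real.log_le_sub_one_of_pos (integral_exp_pos hint)).trans ?_
    rw [sub_le_iff_le_add]
    have hint2 : Integrable (fun x => ε / C * f x + ((ε * M / C) ^ 2 + 1)) μ :=
      (hfi.const_mul _).add (integrable_const _)
    refine (integral_mono hint hint2 fun x => ?_).trans_eq ?_
    · have h1 : infConv f ε x / C ≤ ε / C * f x := by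
        rw [div_mul_eq_mul_div]
        exact div_le_div_of_nonneg_right (infConv_le_mul hf hε.le x) hC.le
      have h2 : |ε / C * f x| ≤ ε * M / C := by
        rw [abs_mul, abs_of_pos (div_pos hε hC), div_mul_eq_mul_div]
        gcongr
        exact hf x
      have h3 := (abs_le.1 (Real.abs_exp_sub_one_sub_id_le
        (h2.trans ((div_le_one hC).2 hεM)))).2
      have h4 : (ε / C * f x) ^ 2 ≤ (ε * M / C) ^ 2 :=
        sq_le_sq' (by linarith [(abs_le.1 h2).1]) (abs_le.1 h2).2
      have h5 := Real.exp_le_exp.2 h1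
      simp only
      linarith
    · rw [integral_add (hfi.const_mul _) (integrable_const _), integral_const_mul]
      simp
      field_simp
      ring
  have hlim : Tendsto (fun ε : ℝ => (∫ x, f x ∂μ) / C + (M / C) ^ 2 * ε) (𝓝[>] 0)
      (𝓝 ((∫ x, f x ∂μ) / C + (M / C) ^ 2 * 0)) :=
    Tendsto.mono_left (Continuous.tendsto (by fun_prop) 0) nhdsWithin_le_nhds
  rw [mul_zero, add_zero] at hlim
  refine ge_of_tendsto hlim ?_
  filter_upwards [Ioc_mem_nhdsGT (show (0 : ℝ) < min 1 (C / (M + 1)) by positivity)] with ε hε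
  exact hsmall ε hε.1 (hε.2.trans (min_le_left _ _)) (hε.2.trans (min_le_right _ _))

end HamiltonJacobi

/-! ### Entropy inequality and Hahn-Banach domination -/

/-- The easy half of the Donsker-Varadhan variational formula. -/
theorem integral_le_toReal_klDiv_add_log {X : Type*} [MeasurableSpace X] {μ ν : Measure X}
    [IsProbabilityMeasure μ] [IsProbabilityMeasure ν] (h : InformationTheory.klDiv ν μ ≠ ∞)
    {g : X → ℝ} (hg : Integrable g ν) (hexp : Integrable (fun x => Real.exp (g x)) μ) :
    ∫ x, g x ∂ν ≤ (InformationTheory.klDiv ν μ).toReal + Real.log (∫ x, Real.exp (g x) ∂μ) := by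
  obtain ⟨hac, hint⟩ := InformationTheory.klDiv_ne_top_iff.1 h
  have := isProbabilityMeasure_tilted hexp
  -- This is nonnegativity of the entropy of `ν` relative to `μ` tilted by `g`.
  have h1 := InformationTheory.integral_llr_add_sub_measure_univ_nonneg
    (hac.trans (absolutelyContinuous_tilted hexp)) (integrable_llr_tilted_right hac hg hint hexp)
  rw [integral_llr_tilted_right hac hg hexp hint] at h1
  rw [InformationTheory.toReal_klDiv_of_measure_eq hac (by simp)]
  simp only [probReal_univ] at h1
  linarith

/-- A sublinear functional on a real vector space dominates a linear functional. -/
theorem exists_linearMap_le_sublinear {E : Type*} [AddCommGroup E] [Module ℝ E] (N : E → ℝ)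
    (hN : ∀ c : ℝ, 0 < c → ∀ x, N (c • x) = c * N x) (hadd : ∀ x y, N (x + y) ≤ N x + N y) :
    ∃ L : E →ₗ[ℝ] ℝ, ∀ x, L x ≤ N x := by
  have h0 : N 0 = 0 := by
    have := hN 2 two_pos 0
    rw [smul_zero] at this
    linarith
  obtain ⟨g, -, hg⟩ := exists_extension_of_le_sublinear (⊥ : E →ₗ.[ℝ] ℝ) N hN hadd (by
    intro x
    have hx : (x : E) = 0 := (Submodule.mem_bot ℝ).1 x.2
    have hx' : x = 0 := Subtype.ext hx
    rw [hx', LinearPMap.map_zero]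
    simp [h0])
  exact ⟨g, hg⟩

/-! ### Kantorovich duality on the integers -/

section CountableDuality

/-- The lift of a function of the first coordinate. -/
def liftFst (a : BoundedContinuousFunction ℕ ℝ) : BoundedContinuousFunction (ℕ × ℕ) ℝ :=
  a.compContinuous ⟨Prod.fst, continuous_fst⟩

/-- The lift of a function of the second coordinate. -/
def liftSnd (b : BoundedContinuousFunction ℕ ℝ) : BoundedContinuousFunction (ℕ × ℕ) ℝ :=
  b.compContinuous ⟨Prod.snd, continuous_snd⟩

@[simp] theorem liftFst_apply (a : BoundedContinuousFunction ℕ ℝ) (p : ℕ × ℕ) :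
    liftFst a p = a p.1 := rfl

@[simp] theorem liftSnd_apply (b : BoundedContinuousFunction ℕ ℝ) (p : ℕ × ℕ) :
    liftSnd b p = b p.2 := rfl

/-- The indicator of a set in a discrete space, as a bounded continuous function. -/
def indicatorFun {ι : Type*} [TopologicalSpace ι] [DiscreteTopology ι] (s : Set ι) :
    BoundedContinuousFunction ι ℝ :=
  BoundedContinuousFunction.indicator s (isClopen_discrete s)

@[simp] theorem indicatorFun_apply {ι : Type*} [TopologicalSpace ι] [DiscreteTopology ι]
    (s : Set ι) (x : ι) : indicatorFun s x = s.indicator 1 x := rfl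

theorem integral_indicatorFun (α : Measure ℕ) (s : Set ℕ) :
    ∫ x, indicatorFun s x ∂α = α.real s := by
  simp only [indicatorFun_apply]
  exact integral_indicator_one (MeasurableSet.of_discrete)

/-- A positive functional on bounded functions on `ℕ × ℕ` whose marginals are measures has
countably additive atoms. -/
theorem tsum_functional_eq {α β : Measure ℕ} [IsProbabilityMeasure α] [IsProbabilityMeasure β]
    (L : BoundedContinuousFunction (ℕ × ℕ) ℝ →ₗ[ℝ] ℝ)
    (hmono : ∀ g h : BoundedContinuousFunction (ℕ × ℕ) ℝ, (∀ p, g p ≤ h p) → L g ≤ L h)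
    (hfst : ∀ a, L (liftFst a) = ∫ x, a x ∂α) (hsnd : ∀ b, L (liftSnd b) = ∫ x, b x ∂β) (i : ℕ) :
    ∑' j, ENNReal.ofReal (L (indicatorFun {(i, j)})) = α {i} := by
  have hpos : ∀ j, 0 ≤ L (indicatorFun {(i, j)}) := fun j => by
    rw [← map_zero L]
    exact hmono _ _ fun p => Set.indicator_nonneg (fun _ _ => zero_le_one) p
  have hsum : ∀ n : ℕ, ∀ p : ℕ × ℕ, (∑ j ∈ Finset.range n, indicatorFun {(i, j)}) p =
      if p.1 = i ∧ p.2 < n then 1 else 0 := by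
    rintro n ⟨k, l⟩
    rw [BoundedContinuousFunction.sum_apply]
    simp only [indicatorFun_apply, Set.indicator_apply, Set.mem_singleton_iff, Prod.mk.injEq,
      Pi.one_apply]
    by_cases hk : k = i
    · simp [hk]
    · simp [hk]
  have hup : ∀ n : ℕ, ∑ j ∈ Finset.range n, L (indicatorFun {(i, j)}) ≤ α.real {i} := fun n => by
    rw [← map_sum, ← integral_indicatorFun, ← hfst]
    refine hmono _ _ fun p => ?_
    rw [hsum]
    simp only [liftFst_apply, indicatorFun_apply, Set.indicator_apply, Set.mem_singleton_iff,
      Pi.one_apply]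
    split_ifs <;> simp_all
  -- The row `{i} × ℕ` is covered by its first `n` points and the strip `ℕ × [n, ∞)`, whose mass is
  -- a tail of `β`: no mass escapes to infinity.
  have hlow : ∀ n : ℕ, α.real {i} - β.real (Set.Ici n) ≤
      ∑ j ∈ Finset.range n, L (indicatorFun {(i, j)}) := fun n => by
    rw [← map_sum, sub_le_iff_le_add, ← integral_indicatorFun, ← integral_indicatorFun,
      ← hfst, ← hsnd, ← map_add]
    refine hmono _ _ fun p => ?_
    rw [BoundedContinuousFunction.add_apply, hsum]
    simp only [liftFst_apply, liftSnd_apply, indicatorFun_apply, Set.indicator_apply,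
      Set.mem_singleton_iff, Pi.one_apply, Set.mem_Ici]
    split_ifs <;> simp_all
  have htail : Tendsto (fun n : ℕ => β.real (Set.Ici n)) atTop (𝓝 0) := by
    have h1 := tendsto_measure_iInter_atTop (μ := β) (s := fun n : ℕ => Set.Ici n)
      (fun n => MeasurableSet.of_discrete.nullMeasurableSet)
      (fun m n hmn => Set.Ici_subset_Ici.2 hmn) ⟨0, measure_ne_top _ _⟩
    have h2 : (⋂ n : ℕ, Set.Ici n) = ∅ := by
      ext x
      simp only [Set.mem_iInter, Set.mem_Ici, Set.mem_empty_iff_false, iff_false, not_forall,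
        not_le]
      exact ⟨x + 1, Nat.lt_succ_self x⟩
    rw [h2, measure_empty] at h1
    exact (ENNReal.tendsto_toReal ENNReal.zero_ne_top).comp h1
  have hlim : Tendsto (fun n : ℕ => ∑ j ∈ Finset.range n, L (indicatorFun {(i, j)})) atTop
      (𝓝 (α.real {i})) := by
    refine tendsto_of_tendsto_of_tendsto_of_le_of_le ?_ tendsto_const_nhds hlow hup
    simpa using tendsto_const_nhds.sub htail
  have h1 := (ENNReal.continuous_ofReal.tendsto _).comp hlim
  rw [ofReal_measureReal (measure_ne_top _ _)] at h1
  refine tendsto_nhds_unique (ENNReal.tendsto_nat_tsum _) (h1.congr fun n => ?_)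
  exact ENNReal.ofReal_sum_of_nonneg fun j _ => hpos j

/-- The values `∫ a dα + ∫ b dβ + s T` over all superhedges `a(i) + b(j) + s c(i, j)` of `h`. -/
def superhedgeValues (α β : Measure ℕ) (c : ℕ → ℕ → ℝ) (T : ℝ)
    (h : BoundedContinuousFunction (ℕ × ℕ) ℝ) : Set ℝ :=
  {r | ∃ a b : BoundedContinuousFunction ℕ ℝ, ∃ s : ℝ, 0 ≤ s ∧
    (∀ p : ℕ × ℕ, h p ≤ a p.1 + b p.2 + s * c p.1 p.2) ∧
    r = ∫ i, a i ∂α + ∫ j, b j ∂β + s * T}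

variable {α β : Measure ℕ} {c : ℕ → ℕ → ℝ} {T : ℝ}

theorem superhedgeValues_nonempty (α β : Measure ℕ) (c : ℕ → ℕ → ℝ) (T : ℝ)
    (h : BoundedContinuousFunction (ℕ × ℕ) ℝ) : (superhedgeValues α β c T h).Nonempty :=
  ⟨_, BoundedContinuousFunction.const ℕ ‖h‖, 0, 0, le_rfl, fun p => by
    simpa using (le_abs_self _).trans (h.norm_coe_le_norm p), rfl⟩

/-- Rescaling a superhedge by `-1/s` gives a dual pair. The bound makes the infimum of the values a
genuine one. -/
theorem neg_norm_le_of_mem_superhedgeValues [IsProbabilityMeasure α] (hc : ∀ i j, 0 ≤ c i j)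
    (hdual : ∀ a b : BoundedContinuousFunction ℕ ℝ, (∀ i j, a i + b j ≤ c i j) →
      ∫ i, a i ∂α + ∫ j, b j ∂β ≤ T)
    (h : BoundedContinuousFunction (ℕ × ℕ) ℝ) {r : ℝ} (hr : r ∈ superhedgeValues α β c T h) :
    -‖h‖ ≤ r := by
  obtain ⟨a, b, s, hs, hab, rfl⟩ := hr
  -- `s` may vanish, so the rescaling uses `s + δ` and lets `δ → 0`.
  have hlim : Tendsto (fun δ : ℝ => ∫ i, a i ∂α + ∫ j, b j ∂β + (s + δ) * T) (𝓝[>] 0)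
      (𝓝 (∫ i, a i ∂α + ∫ j, b j ∂β + (s + 0) * T)) :=
    Tendsto.mono_left (Continuous.tendsto (by fun_prop) 0) nhdsWithin_le_nhds
  rw [add_zero] at hlim
  refine ge_of_tendsto hlim ?_
  filter_upwards [self_mem_nhdsWithin] with δ hδ
  have hsδ : 0 < s + δ := add_pos_of_nonneg_of_pos hs hδ
  have h1 := hdual ((s + δ)⁻¹ • (-a - BoundedContinuousFunction.const ℕ ‖h‖))
    ((s + δ)⁻¹ • (-b)) fun i j => by
      have h2 := (abs_le.1 (h.norm_coe_le_norm (i, j))).1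
      have h3 := hab (i, j)
      change (s + δ)⁻¹ * (-a i - ‖h‖) + (s + δ)⁻¹ * (-b j) ≤ c i j
      rw [← mul_add, inv_mul_le_iff₀ hsδ]
      have h4 : 0 ≤ δ * c i j := mul_nonneg (le_of_lt hδ) (hc i j)
      simp only at h3
      linarith
  have h2 : ∫ i, ((s + δ)⁻¹ • (-a - BoundedContinuousFunction.const ℕ ‖h‖)) i ∂α =
      (s + δ)⁻¹ * (-∫ i, a i ∂α - ‖h‖) := by
    change ∫ i, (s + δ)⁻¹ * (-a i - ‖h‖) ∂α = _
    rw [integral_const_mul, integral_sub (a.integrable α).fun_neg (integrable_const _), integral_neg]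
    simp
  have h3 : ∫ j, ((s + δ)⁻¹ • (-b)) j ∂β = (s + δ)⁻¹ * (-∫ j, b j ∂β) := by
    change ∫ j, (s + δ)⁻¹ * (-b j) ∂β = _
    rw [integral_const_mul, integral_neg]
  rw [h2, h3, ← mul_add, inv_mul_le_iff₀ hsδ] at h1
  linarith

theorem smul_mem_superhedgeValues {h : BoundedContinuousFunction (ℕ × ℕ) ℝ} {r k : ℝ}
    (hr : r ∈ superhedgeValues α β c T h) (hk : 0 < k) :
    k * r ∈ superhedgeValues α β c T (k • h) := by
  obtain ⟨a, b, s, hs, hab, rfl⟩ := hr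
  refine ⟨k • a, k • b, k * s, mul_nonneg hk.le hs, fun p => ?_, ?_⟩
  · have := mul_le_mul_of_nonneg_left (hab p) hk.le
    change k * h p ≤ k * a p.1 + k * b p.2 + k * s * c p.1 p.2
    linarith
  · change _ = ∫ i, k * a i ∂α + ∫ j, k * b j ∂β + _
    rw [integral_const_mul, integral_const_mul]
    ring

theorem add_mem_superhedgeValues [IsFiniteMeasure α] [IsFiniteMeasure β]
    {g h : BoundedContinuousFunction (ℕ × ℕ) ℝ} {r r' : ℝ}
    (hr : r ∈ superhedgeValues α β c T g) (hr' : r' ∈ superhedgeValues α β c T h) :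
    r + r' ∈ superhedgeValues α β c T (g + h) := by
  obtain ⟨a, b, s, hs, hab, rfl⟩ := hr
  obtain ⟨a', b', s', hs', hab', rfl⟩ := hr'
  refine ⟨a + a', b + b', s + s', add_nonneg hs hs', fun p => ?_, ?_⟩
  · have h1 := hab p
    have h2 := hab' p
    change g p + h p ≤ a p.1 + a' p.1 + (b p.2 + b' p.2) + (s + s') * c p.1 p.2
    linarith
  · change _ = ∫ i, (a i + a' i) ∂α + ∫ j, (b j + b' j) ∂β + _
    rw [integral_add (a.integrable α) (a'.integrable α),
      integral_add (b.integrable β) (b'.integrable β)]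
    ring

/-- If the dual value is at most `T`, some linear functional lies below the superhedging values. -/
theorem exists_functional_of_forall_dual [IsProbabilityMeasure α] [IsProbabilityMeasure β]
    (hc : ∀ i j, 0 ≤ c i j)
    (hdual : ∀ a b : BoundedContinuousFunction ℕ ℝ, (∀ i j, a i + b j ≤ c i j) →
      ∫ i, a i ∂α + ∫ j, b j ∂β ≤ T) :
    ∃ L : BoundedContinuousFunction (ℕ × ℕ) ℝ →ₗ[ℝ] ℝ,
      ∀ h, ∀ r ∈ superhedgeValues α β c T h, L h ≤ r := by
  have hne := superhedgeValues_nonempty α β c T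
  have hNle : ∀ h, ∀ r ∈ superhedgeValues α β c T h, sInf (superhedgeValues α β c T h) ≤ r :=
    fun h r hr => csInf_le ⟨-‖h‖, fun _ => neg_norm_le_of_mem_superhedgeValues hc hdual h⟩ hr
  have hNsmul_le : ∀ k : ℝ, 0 < k → ∀ h, sInf (superhedgeValues α β c T (k • h)) ≤
      k * sInf (superhedgeValues α β c T h) := by
    intro k hk h
    rw [← div_le_iff₀' hk]
    refine le_csInf (hne h) fun r hr => ?_
    rw [div_le_iff₀' hk]
    exact hNle _ _ (smul_mem_superhedgeValues hr hk)
  obtain ⟨L, hL⟩ := exists_linearMap_le_sublinear (fun h => sInf (superhedgeValues α β c T h))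
    (fun k hk h => by
      refine le_antisymm (hNsmul_le k hk h) ?_
      have h1 := hNsmul_le k⁻¹ (inv_pos.2 hk) (k • h)
      rw [smul_smul, inv_mul_cancel₀ hk.ne', one_smul] at h1
      rwa [← le_inv_mul_iff₀ hk])
    (fun g h => by
      rw [← sub_le_iff_le_add]
      refine le_csInf (hne g) fun r hr => ?_
      rw [sub_le_comm]
      refine le_csInf (hne h) fun r' hr' => ?_
      rw [sub_le_iff_le_add, add_comm r' r]
      exact hNle _ _ (add_mem_superhedgeValues hr hr'))
  exact ⟨L, fun h r hr => (hL h).trans (hNle h r hr)⟩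

/-- Kantorovich duality on a countable space. -/
theorem exists_matrix_of_forall_dual [IsProbabilityMeasure α] [IsProbabilityMeasure β]
    (hc : ∀ i j, 0 ≤ c i j)
    (hdual : ∀ a b : BoundedContinuousFunction ℕ ℝ, (∀ i j, a i + b j ≤ c i j) →
      ∫ i, a i ∂α + ∫ j, b j ∂β ≤ T) :
    ∃ w : ℕ → ℕ → ℝ≥0∞, (∀ i, ∑' j, w i j = α {i}) ∧ (∀ j, ∑' i, w i j = β {j}) ∧
      ∑' i, ∑' j, w i j * ENNReal.ofReal (c i j) ≤ ENNReal.ofReal T := by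
  obtain ⟨L, hLS⟩ := exists_functional_of_forall_dual hc hdual
  have hmono : ∀ g h : BoundedContinuousFunction (ℕ × ℕ) ℝ, (∀ p, g p ≤ h p) → L g ≤ L h := by
    intro g h hgh
    rw [← sub_nonpos, ← map_sub]
    -- A nonpositive function is superhedged by zero at no cost, so `L` is positive.
    refine hLS _ _ ⟨0, 0, 0, le_rfl, fun p => ?_, by simp⟩
    simpa using hgh p
  have hfst : ∀ a, L (liftFst a) = ∫ x, a x ∂α := by
    -- A lifted function hedges itself; applying this to `-a` as well gives equality.
    have h1 : ∀ a, L (liftFst a) ≤ ∫ x, a x ∂α := fun a =>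
      hLS _ _ ⟨a, 0, 0, le_rfl, fun p => by simp, by simp⟩
    refine fun a => le_antisymm (h1 a) ?_
    have h2 := h1 (-a)
    rw [show liftFst (-a) = -liftFst a from rfl, map_neg] at h2
    simp only [BoundedContinuousFunction.coe_neg, Pi.neg_apply, integral_neg] at h2
    linarith
  have hsnd : ∀ b, L (liftSnd b) = ∫ x, b x ∂β := by
    have h1 : ∀ b, L (liftSnd b) ≤ ∫ x, b x ∂β := fun b =>
      hLS _ _ ⟨0, b, 0, le_rfl, fun p => by simp, by simp⟩
    refine fun b => le_antisymm (h1 b) ?_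
    have h2 := h1 (-b)
    rw [show liftSnd (-b) = -liftSnd b from rfl, map_neg] at h2
    simp only [BoundedContinuousFunction.coe_neg, Pi.neg_apply, integral_neg] at h2
    linarith
  refine ⟨fun i j => ENNReal.ofReal (L (indicatorFun {(i, j)})),
    tsum_functional_eq L hmono hfst hsnd, fun j => ?_, ?_⟩
  · let L' : BoundedContinuousFunction (ℕ × ℕ) ℝ →ₗ[ℝ] ℝ :=
      { toFun := fun h => L (h.compContinuous ⟨Prod.swap, continuous_swap⟩)
        map_add' := fun g h => L.map_add (g.compContinuous ⟨Prod.swap, continuous_swap⟩)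
          (h.compContinuous ⟨Prod.swap, continuous_swap⟩)
        map_smul' := fun k h =>
          L.map_smul k (h.compContinuous ⟨Prod.swap, continuous_swap⟩) }
    have h1 := tsum_functional_eq (α := β) (β := α) L' (fun g h hgh => hmono _ _ fun p => hgh _)
      hsnd hfst j
    rw [← h1]
    refine tsum_congr fun i => ?_
    change _ = ENNReal.ofReal (L ((indicatorFun {(j, i)}).compContinuous
      ⟨Prod.swap, continuous_swap⟩))
    have h2 : (indicatorFun {(i, j)} : BoundedContinuousFunction (ℕ × ℕ) ℝ) =
        (indicatorFun {(j, i)}).compContinuous ⟨Prod.swap, continuous_swap⟩ := by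
      ext ⟨k, l⟩
      simp [Set.indicator_apply, and_comm]
    rw [← h2]
  · rw [← ENNReal.tsum_prod (f := fun i j => ENNReal.ofReal (L (indicatorFun {(i, j)})) *
      ENNReal.ofReal (c i j)), ENNReal.tsum_eq_iSup_sum]
    refine iSup_le fun F => ?_
    have hpos : ∀ p : ℕ × ℕ, 0 ≤ L (indicatorFun {(p.1, p.2)}) := fun p => by
      rw [← map_zero L]
      exact hmono _ _ fun q => Set.indicator_nonneg (fun _ _ => zero_le_one) q
    simp_rw [← ENNReal.ofReal_mul (hpos _)]
    rw [← ENNReal.ofReal_sum_of_nonneg fun p _ => mul_nonneg (hpos p) (hc _ _)]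
    refine ENNReal.ofReal_le_ofReal ?_
    have h1 : ∑ p ∈ F, L (indicatorFun {(p.1, p.2)}) * c p.1 p.2 =
        L (∑ p ∈ F, c p.1 p.2 • indicatorFun {(p.1, p.2)}) := by
      simp [map_sum, mul_comm]
    rw [h1]
    -- One unit of the cost, of price `T`, dominates every finite truncation of `c`.
    refine hLS _ _ ⟨0, 0, 1, zero_le_one, fun q => ?_, by simp⟩
    rw [BoundedContinuousFunction.sum_apply]
    simp only [BoundedContinuousFunction.coe_smul, indicatorFun_apply, Set.indicator_apply,
      Set.mem_singleton_iff, Pi.one_apply, smul_eq_mul, mul_ite, mul_one, mul_zero,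
      BoundedContinuousFunction.coe_zero, Pi.zero_apply, zero_add, one_mul, Prod.mk.eta]
    rw [Finset.sum_ite_eq]
    split_ifs
    · exact le_rfl
    · exact hc _ _

end CountableDuality

/-! ### Couplings from matrices on a countable partition -/

section Coupling

open ProbabilityTheory

theorem tsum_measure_preimage_inter {X : Type*} [MeasurableSpace X] (ν : Measure X) {ι : X → ℕ}
    (hι : Measurable ι) {s : Set X} (hs : MeasurableSet s) :
    ∑' i, ν (ι ⁻¹' {i} ∩ s) = ν s := by
  rw [← measure_iUnion]
  · congr 1
    ext x
    simp
  · intro i j hij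
    refine Set.disjoint_left.2 fun x hx hx' => hij ?_
    exact hx.1.symm.trans hx'.1
  · exact fun i => (hι (measurableSet_singleton i)).inter hs

theorem tsum_tsum_mul_cond {X : Type*} [MeasurableSpace X] {ν μ : Measure X}
    [IsProbabilityMeasure ν] [IsProbabilityMeasure μ] {ι : X → ℕ} (hι : Measurable ι)
    {w : ℕ → ℕ → ℝ≥0∞} (h1 : ∀ i, ∑' j, w i j = ν (ι ⁻¹' {i}))
    (h2 : ∀ j, ∑' i, w i j = μ (ι ⁻¹' {j})) {s : Set X} (hs : MeasurableSet s) :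
    ∑' i, ∑' j, w i j * (μ[Set.univ | ι ⁻¹' {j}] * ν[s | ι ⁻¹' {i}]) = ν s := by
  have h3 : ∀ i j, w i j * (μ[Set.univ | ι ⁻¹' {j}] * ν[s | ι ⁻¹' {i}]) =
      w i j * ν[s | ι ⁻¹' {i}] := by
    intro i j
    -- Conditioning on a null cell gives the zero measure, but then the column of `w` vanishes too.
    by_cases hj : μ (ι ⁻¹' {j}) = 0
    · have : w i j = 0 := by
        have h4 := h2 j
        rw [hj, ENNReal.tsum_eq_zero] at h4
        exact h4 i
      simp [this]
    · have := cond_isProbabilityMeasure hj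
      simp
  simp_rw [h3, ENNReal.tsum_mul_right, h1]
  rw [← tsum_measure_preimage_inter ν hι hs]
  refine tsum_congr fun i => ?_
  rw [mul_comm, cond_mul_eq_inter (hι (measurableSet_singleton i))]

/-- A matrix with the marginals of `ν` and `μ` along a countable partition is realized by a
coupling. -/
theorem exists_coupling_of_matrix {X : Type*} [MeasurableSpace X] {ν μ : Measure X}
    [IsProbabilityMeasure ν] [IsProbabilityMeasure μ] {ι : X → ℕ} (hι : Measurable ι)
    {w : ℕ → ℕ → ℝ≥0∞} (h1 : ∀ i, ∑' j, w i j = ν (ι ⁻¹' {i}))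
    (h2 : ∀ j, ∑' i, w i j = μ (ι ⁻¹' {j})) :
    ∃ π : Measure (X × X), IsCoupling π ν μ ∧ ∀ (F : X × X → ℝ≥0∞) (κ : ℕ → ℕ → ℝ≥0∞),
      (∀ p, F p ≤ κ (ι p.1) (ι p.2)) → ∫⁻ p, F p ∂π ≤ ∑' i, ∑' j, w i j * κ i j := by
  have hA : ∀ i, MeasurableSet (ι ⁻¹' {i}) := fun i => hι (measurableSet_singleton i)
  -- `w` distributes mass among pairs of cells; within a pair the coordinates are independent.
  let π : Measure (X × X) := Measure.sum fun p : ℕ × ℕ =>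
    w p.1 p.2 • (ν[|ι ⁻¹' {p.1}]).prod (μ[|ι ⁻¹' {p.2}])
  refine ⟨π, ⟨?_, ?_⟩, fun F κ hF => ?_⟩
  · ext s hs
    rw [Measure.map_sum measurable_fst.aemeasurable, Measure.sum_apply _ hs,
      ← tsum_tsum_mul_cond hι h1 h2 hs, ← ENNReal.tsum_prod]
    refine tsum_congr fun p => ?_
    rw [Measure.map_smul, Measure.map_fst_prod]
    simp
  · ext s hs
    rw [Measure.map_sum measurable_snd.aemeasurable, Measure.sum_apply _ hs,
      ← tsum_tsum_mul_cond (w := fun i j => w j i) hι h2 h1 hs, ENNReal.tsum_comm,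
      ← ENNReal.tsum_prod (f := fun i j => w i j *
        (ν[Set.univ | ι ⁻¹' {i}] * μ[s | ι ⁻¹' {j}]))]
    refine tsum_congr fun p => ?_
    rw [Measure.map_smul, Measure.map_snd_prod]
    simp
  · rw [lintegral_sum_measure, ← ENNReal.tsum_prod (f := fun i j => w i j * κ i j)]
    refine ENNReal.tsum_le_tsum fun p => ?_
    rw [lintegral_smul_measure, smul_eq_mul]
    gcongr
    set ν' := ν[|ι ⁻¹' {p.1}] with hν'
    set μ' := μ[|ι ⁻¹' {p.2}] with hμ'
    have e1 : ∀ᵐ x ∂ν', ι x = p.1 := ae_cond_mem (hA _)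
    have e2 : ∀ᵐ y ∂μ', ι y = p.2 := ae_cond_mem (hA _)
    have hae : ∀ᵐ q ∂(ν'.prod μ'), F q ≤ κ p.1 p.2 := by
      have e3 : ∀ᵐ q ∂(ν'.prod μ'), ι q.1 = p.1 :=
        Measure.quasiMeasurePreserving_fst.ae e1
      have e4 : ∀ᵐ q ∂(ν'.prod μ'), ι q.2 = p.2 :=
        Measure.quasiMeasurePreserving_snd.ae e2
      filter_upwards [e3, e4] with q hq hq'
      rw [← hq, ← hq']
      exact hF q
    refine (lintegral_mono_ae hae).trans ?_
    rw [lintegral_const]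
    refine mul_le_of_le_one_right' ?_
    rw [← Set.univ_prod_univ, Measure.prod_prod]
    exact mul_le_one' prob_le_one prob_le_one

end Coupling

/-! ### Kantorovich duality on a separable metric space -/

/-- A separable metric space has a countable measurable partition into small sets. -/
theorem exists_measurable_index {X : Type*} [MetricSpace X] [TopologicalSpace.SeparableSpace X]
    [Nonempty X] [MeasurableSpace X] [BorelSpace X] {δ : ℝ} (hδ : 0 < δ) :
    ∃ (ι : X → ℕ) (z : ℕ → X), Measurable ι ∧ ∀ x, dist x (z (ι x)) < δ := by
  classical
  have hex : ∀ x : X, ∃ n, dist x (TopologicalSpace.denseSeq X n) < δ := fun x => by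
    simpa using (TopologicalSpace.denseRange_denseSeq X).exists_dist_lt x hδ
  refine ⟨fun x => Nat.find (hex x), TopologicalSpace.denseSeq X, measurable_find hex fun k => ?_,
    fun x => Nat.find_spec (hex x)⟩
  exact (isOpen_lt (by fun_prop) continuous_const).measurableSet

/-- Kantorovich duality for the quadratic cost. -/
theorem transportCost_le_of_forall_infConv {X : Type*} [MetricSpace X] [TopologicalSpace.SeparableSpace X]
    [MeasurableSpace X] [BorelSpace X] {ν μ : Measure X} [IsProbabilityMeasure ν]
    [IsProbabilityMeasure μ] {T : ℝ} (hT : 0 ≤ T)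
    (hdual : ∀ (f : X → ℝ) (M : ℝ), Measurable f → (∀ x, |f x| ≤ M) →
      ∫ x, infConv f 1 x ∂ν ≤ ∫ x, f x ∂μ + T) :
    transportCost ν μ ≤ ENNReal.ofReal T := by
  have : Nonempty X := μ.nonempty_of_neZero
  have hδ : ∀ δ, 0 < δ → transportCost ν μ ≤
      ENNReal.ofReal ((1 + δ) * T + (16 * δ + 16 * δ ^ 2)) := by
    intro δ hδ
    obtain ⟨ι, z, hι, hz⟩ := exists_measurable_index (X := X) hδ
    have := Measure.isProbabilityMeasure_map (μ := ν) hι.aemeasurable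
    have := Measure.isProbabilityMeasure_map (μ := μ) hι.aemeasurable
    -- A distance between cells, constant on pairs of cells, below `ρ` and within `4 * δ` of it.
    let m : ℕ → ℕ → ℝ := fun i j => max 0 (dist (z i) (z j) - 2 * δ)
    have hm : ∀ i j, 0 ≤ m i j := fun i j => le_max_left _ _
    have hm1 : ∀ x y, m (ι x) (ι y) ≤ dist x y := fun x y => by
      refine max_le dist_nonneg ?_
      have h1 := dist_triangle4 (z (ι x)) x y (z (ι y))
      have h2 := hz x
      have h3 := hz y
      rw [dist_comm] at h2
      linarith
    have hm2 : ∀ x y, dist x y ≤ m (ι x) (ι y) + 4 * δ := fun x y => by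
      have h1 := dist_triangle4 x (z (ι x)) (z (ι y)) y
      have h2 := hz x
      have h3 := hz y
      rw [dist_comm] at h3
      have h4 := le_max_right 0 (dist (z (ι x)) (z (ι y)) - 2 * δ)
      simp only [m]
      linarith
    obtain ⟨w, h1, h2, hw⟩ := exists_matrix_of_forall_dual (α := ν.map ι) (β := μ.map ι)
      (c := fun i j => m i j ^ 2) (T := T) (fun i j => sq_nonneg _) (fun a b hab => by
        have hf : ∀ y, |-b (ι y)| ≤ ‖b‖ := fun y => by
          rw [abs_neg]; exact b.norm_coe_le_norm _
        have hfm : Measurable fun y => -b (ι y) := (Measurable.of_discrete.comp hι).neg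
        have hd := hdual (fun y => -b (ι y)) ‖b‖ hfm hf
        rw [integral_map hι.aemeasurable Measurable.of_discrete.aestronglyMeasurable,
          integral_map hι.aemeasurable Measurable.of_discrete.aestronglyMeasurable]
        rw [integral_neg] at hd
        have ha : Integrable (fun x => a (ι x)) ν :=
          Integrable.of_bound (Measurable.of_discrete.comp hι).aestronglyMeasurable ‖a‖
            (Eventually.of_forall fun x => a.norm_coe_le_norm _)
        have hi : Integrable (fun x => infConv (fun y => -b (ι y)) 1 x) ν :=
          integrable_comp_infConv hf zero_le_one zero_le_one continuous_fst
        -- Since `m ≤ ρ`, a dual pair for `m²` puts `a ∘ ι` below the inf-convolution of `-b ∘ ι`.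
        have := integral_mono ha hi fun x => le_ciInf fun y => by
          have h3 := hab (ι x) (ι y)
          have h4 := pow_le_pow_left₀ (hm _ _) (hm1 x y) 2
          linarith
        linarith)
    simp_rw [Measure.map_apply hι (measurableSet_singleton _)] at h1 h2
    obtain ⟨π, hπ, hcost⟩ := exists_coupling_of_matrix hι h1 h2
    refine (iInf₂_le π hπ).trans ((hcost _ (fun i j => ENNReal.ofReal (1 + δ) *
      ENNReal.ofReal (m i j ^ 2) + ENNReal.ofReal (16 * δ + 16 * δ ^ 2)) fun p => ?_).trans ?_)
    · rw [edist_dist, ← ENNReal.ofReal_pow dist_nonneg, ← ENNReal.ofReal_mul (by positivity),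
        ← ENNReal.ofReal_add (by positivity) (by positivity)]
      refine ENNReal.ofReal_le_ofReal ?_
      have h3 := pow_le_pow_left₀ dist_nonneg (hm2 p.1 p.2) 2
      -- `(m + 4δ)² = (1 + δ) m² + 16δ + 16δ² - δ (m - 4)²`.
      nlinarith [mul_nonneg hδ.le (sq_nonneg (m (ι p.1) (ι p.2) - 4))]
    · have h3 : ∑' i, ∑' j, w i j = 1 := by
        simp_rw [h1]
        simpa using tsum_measure_preimage_inter ν hι MeasurableSet.univ
      simp_rw [mul_add, ENNReal.tsum_add, ENNReal.tsum_mul_right, h3, one_mul,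
        mul_left_comm _ (ENNReal.ofReal (1 + δ)), ENNReal.tsum_mul_left]
      rw [ENNReal.ofReal_add (p := (1 + δ) * T) (by positivity) (by positivity),
        ENNReal.ofReal_mul (by positivity)]
      gcongr
  have hlim : Tendsto (fun δ : ℝ => ENNReal.ofReal ((1 + δ) * T + (16 * δ + 16 * δ ^ 2))) (𝓝[>] 0)
      (𝓝 (ENNReal.ofReal ((1 + 0) * T + (16 * 0 + 16 * 0 ^ 2)))) :=
    ((ENNReal.continuous_ofReal.comp (by fun_prop)).tendsto 0).mono_left nhdsWithin_le_nhds
  simp only [add_zero, one_mul, mul_zero, ne_eq, OfNat.ofNat_ne_zero, not_false_eq_true,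
    zero_pow] at hlim
  refine ge_of_tendsto hlim ?_
  filter_upwards [self_mem_nhdsWithin] with δ h
  exact hδ δ h

end TransportLSI

end

/-! ### Conclusion -/

theorem mainTheorem3 {X : Type*} [MetricSpace X] [PolishSpace X] [MeasurableSpace X]
    [BorelSpace X] (μ : Measure X) [IsProbabilityMeasure μ] (C : ℝ) (hC : 0 < C)
    (hLSI : TransportLSI.LSIPlus C μ) : TransportLSI.TalagrandT2 C μ := by
  intro ν hν
  by_cases htop : InformationTheory.klDiv ν μ = ∞
  · rw [htop, ENNReal.mul_top (by simpa using hC)]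
    exact le_top
  rw [← ENNReal.ofReal_toReal htop, ← ENNReal.ofReal_mul hC.le]
  refine TransportLSI.transportCost_le_of_forall_infConv
    (mul_nonneg hC.le ENNReal.toReal_nonneg) fun f M hfm hf => ?_
  have hexp : Integrable (fun x => Real.exp (TransportLSI.infConv f 1 x / C)) μ :=
    TransportLSI.integrable_comp_infConv hf zero_le_one zero_le_one
      (φ := fun p => Real.exp (p.1 / C)) (by fun_prop)
  have hint : Integrable (fun x => TransportLSI.infConv f 1 x / C) ν :=
    TransportLSI.integrable_comp_infConv hf zero_le_one zero_le_one
      (φ := fun p => p.1 / C) (by fun_prop)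
  have h1 := TransportLSI.integral_le_toReal_klDiv_add_log htop hint hexp
  have h2 := hLSI.log_integral_exp_infConv_le hC hf hfm
  rw [integral_div, div_le_iff₀ hC] at h1
  rw [le_div_iff₀ hC] at h2
  linarith
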